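/- Let $n\ge 2$. A convex body is a nonempty compact convex subset of $\mathbb R^n$. For convex bodies $K,C$ let $R(K,C)=\inf\{\rho\ge 0:\exists t\in\mathbb R^n,\ K\subset t+\rho C\}$ be the circumradius and $s(C)=R(C,-C)$ the Minkowski asymmetry. A convex body $C$ is called Minkowski-centered if $C\subset -s(C)\,C$ and $R(C,-s(C)C)=1$. For $C$ with $0$ in its interior let $\|x\|_C=\min\{\lambda\ge 0: x\in\lambda C\}$ be the gauge function of $C$, and let the minimum diameter be $$D_{\mathrm{MIN}}(K,C)=\max_{s\in\mathbb R^n\setminus\{0\}}\ l_{s,\mathrm{MIN}}(K,C),\qquad l_{s,\mathrm{MIN}}(K,C)=\max\{\|x-y\|_C : x,y\in K,\ x-y\in \mathrm{lin}(s)\},$$ where $\mathrm{lin}(s)$ is the linear span of $s$. (a) For every convex body $K\subset\mathbb R^n$ that is not a single point and every Minkowski-centered convex body $C\subset\mathbb R^n$ with $0$ in its interior, $$\frac{n+1}{2n}\le\frac{D_{\mathrm{MIN}}(K,C)}{2R(K,C)},$$ and equality can hold only if $K$ is an $n$-dimensional simplex. (b) For every real $s\in[1,n]$ there exist a Minkowski-centered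 convex body $C\subset\mathbb R^n$ with $0$ in its interior and $s(C)=s$, and an $n$-dimensional simplex $K$, such that equality holds in (a). -/

import Mathlib

open scoped Pointwise

noncomputable section

namespace GaugeGeometry

variable {E : Type*} [AddCommGroup E] [Module ℝ E]

/-- The circumradius `R(K, C)`: the infimum of all `ρ ≥ 0` such that `K` is contained in a
translate of `ρ C`. -/
def circumradius (K C : Set E) : ℝ :=
  sInf {ρ : ℝ | 0 ≤ ρ ∧ ∃ t : E, K ⊆ t +ᵥ ρ • C}

/-- `K` is optimally contained in `C`: `K ⊆ C` and `R(K, C) = 1`. -/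
def OptContained (K C : Set E) : Prop :=
  K ⊆ C ∧ circumradius K C = 1

/-- The Minkowski asymmetry `s(C) = R(C, -C)`. -/
def asymmetry (C : Set E) : ℝ :=
  circumradius C (-C)

/-- `C` is Minkowski-centered: `C` is optimally contained in `-s(C) C`. -/
def IsMinkowskiCentered (C : Set E) : Prop :=
  OptContained C ((-asymmetry C) • C)

/-- The symmetric `s`-length of `K` with respect to the gauge body `C`: the largest value of the
gauge function of `C` on the differences `x - y` of points of `K` that lie on the line spanned
by `s`. -/
def minLength (s : E) (K C : Set E) : ℝ :=
  sSup (gauge C '' ((K - K) ∩ (Submodule.span ℝ {s} : Set E)))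

/-- The minimum diameter: the maximal symmetric `s`-length over all directions `s ≠ 0`. -/
def minDiameter (K C : Set E) : ℝ :=
  sSup ((fun s : E => minLength s K C) '' {s : E | s ≠ 0})

/-- `K` is an `n`-dimensional simplex: the convex hull of `n + 1` affinely independent points. -/
def IsSimplex (n : ℕ) (K : Set E) : Prop :=
  ∃ p : Fin (n + 1) → E, AffineIndependent ℝ p ∧ K = convexHull ℝ (Set.range p)

end GaugeGeometry

end

/-! The bound comes from Minkowski's covering by a reflected copy. If `K ⊆ t - s K`, then each `x ∈
K` has some `k ∈ K` with `s k = t - x`, so `(s + 1) x = t + s (x - k)`. As `x - k` lies in `D_MIN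
C`, this gives `R ≤ s / (s + 1) * D_MIN`. Helly's theorem supplies `s = n`, hence the inequality.
For equality, a body that is not an `n`-simplex admits some `s < n`
(`exists_lt_forall_sub_mem_smul`): on `n + 1` points an extra relation lowers the factor, and
compactness of `K^(n+1)` makes the gain uniform. As `s / (s + 1)` increases with `s`, the inequality
is then strict.

Sharpness uses a centered simplex `T` and `C = (-T) ∩ (s T)`. Facet functionals with zero sum reduce
every lower bound on a radius to an average in which the translation cancels. -/

open Module
open scoped Topology

namespace GaugeGeometry

/-! ### Covering a convex body by a reflected copy -/

section Reflection

variable {E : Type*} [NormedAddCommGroup E] [NormedSpace ℝ E] {K : Set E}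

theorem sum_smul_mem_smul {ι : Type*} [Fintype ι] (hK : Convex ℝ K) (hne : K.Nonempty)
    {u : ι → ℝ} (hu : ∀ i, 0 ≤ u i) {z : ι → E} (hz : ∀ i, z i ∈ K) :
    ∑ i, u i • z i ∈ (∑ i, u i) • K := by
  rcases (Finset.sum_nonneg fun i _ => hu i : 0 ≤ ∑ i, u i).eq_or_lt with h | h
  · have h0 : ∀ i, u i = 0 := fun i =>
      (Finset.sum_eq_zero_iff_of_nonneg fun i _ => hu i).1 h.symm i (Finset.mem_univ i)
    simp [h0, Set.zero_smul_set hne]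
  · refine ⟨_, hK.centerMass_mem (t := Finset.univ) (fun i _ => hu i) h fun i _ => hz i, ?_⟩
    simp [Finset.centerMass, smul_smul, h.ne']

/-- A larger dilation factor is at least as good for covering a set by a reflected copy. -/
theorem exists_sub_mem_smul_mono (hK : Convex ℝ K) {p : E} (hp : p ∈ K) {s s' : ℝ} (hs : 0 ≤ s)
    (hss : s ≤ s') {x t : E} (h : t - x ∈ s • K) : (t + (s' - s) • p) - x ∈ s' • K := by
  have h1 : s' • K = s • K + (s' - s) • K := by
    rw [← hK.add_smul hs (sub_nonneg.2 hss)]; congr 1; ring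
  rw [h1, add_sub_right_comm]
  exact Set.add_mem_add h (Set.smul_mem_smul_set hp)

/-- Helly's theorem for covering `K` by a translate of `-s K`. -/
theorem exists_forall_sub_mem_smul [FiniteDimensional ℝ E] (hK : Convex ℝ K) (hc : IsCompact K)
    (hne : K.Nonempty) {d : ℕ} (hd : finrank ℝ E ≤ d) {s : ℝ}
    (h : ∀ x : Fin (d + 1) → E, (∀ i, x i ∈ K) → ∃ t, ∀ i, t - x i ∈ s • K) :
    ∃ t, ∀ x ∈ K, t - x ∈ s • K := by
  obtain ⟨p, hp⟩ := hne
  let F : K → Set E := fun x => (fun k => k + (x : E)) '' (s • K)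
  have hF : ∀ x t, t ∈ F x ↔ t - x ∈ s • K := fun x t =>
    ⟨by rintro ⟨k, hk, rfl⟩; simpa using hk, fun ht => ⟨_, ht, by simp⟩⟩
  have key : (⋂ x, F x).Nonempty := by
    refine Convex.helly_theorem_compact' (𝕜 := ℝ) (fun x => ?_) (fun x => ?_) fun I hI => ?_
    · have := (hK.smul s).translate (x : E)
      simpa only [F, add_comm] using this
    · exact (hc.smul s).image (by fun_prop)
    · have hI' : I.card ≤ d + 1 := hI.trans (by lia)
      -- A subfamily with fewer than `d + 1` members is padded with `p`.
      obtain ⟨t, ht⟩ := h (fun i => if hi : (i : ℕ) < I.card then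
        ((I.equivFin.symm ⟨i, hi⟩ : K) : E) else p) fun i => by
          split_ifs
          exacts [Subtype.coe_prop _, hp]
      refine ⟨t, Set.mem_iInter₂.2 fun x hx => (hF x t).2 ?_⟩
      have := ht ⟨I.equivFin ⟨x, hx⟩, (I.equivFin ⟨x, hx⟩).2.trans_le hI'⟩
      simpa using this
  obtain ⟨t, ht⟩ := key
  exact ⟨t, fun x hx => (hF ⟨x, hx⟩ t).1 (Set.mem_iInter.1 ht ⟨x, hx⟩)⟩

/-- Minkowski's bound: a convex body is covered by a translate of `-d K`, `d` the dimension. -/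
theorem exists_forall_sub_mem_natCast_smul [FiniteDimensional ℝ E] (hK : Convex ℝ K)
    (hc : IsCompact K) (hne : K.Nonempty) {d : ℕ} (hd : finrank ℝ E ≤ d) :
    ∃ t, ∀ x ∈ K, t - x ∈ (d : ℝ) • K := by
  -- Removing `x i` from the sum of all `d + 1` points leaves a sum of `d` points of `K`.
  refine exists_forall_sub_mem_smul hK hc hne hd fun x hx => ⟨∑ j, x j, fun i => ?_⟩
  have := sum_smul_mem_smul hK hne (u := fun j => if j = i then (0 : ℝ) else 1)
    (fun j => by positivity) hx
  have h1 : ∑ j, (if j = i then (0 : ℝ) else 1) = d := by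
    simp [Finset.sum_ite, Finset.filter_ne', Finset.card_erase_of_mem]
  have h2 : ∑ j, (if j = i then (0 : ℝ) else 1) • x j = ∑ j, x j - x i := by
    rw [eq_sub_iff_add_eq, ← Finset.sum_erase_add _ _ (Finset.mem_univ i),
      ← Finset.sum_erase_add (a := i) (f := x) _ (Finset.mem_univ i)]
    simp only [if_true, zero_smul, add_zero]
    congr 1
    exact Finset.sum_congr rfl fun j hj => by simp [Finset.ne_of_mem_erase hj]
  rwa [h1, h2] at this

/-- A convex body that does not span the space is covered by a translate of `-(n-1) K`. -/
theorem exists_forall_sub_mem_smul_of_affineSpan_ne_top [FiniteDimensional ℝ E]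
    (hK : Convex ℝ K) (hc : IsCompact K) (hne : K.Nonempty) (hspan : affineSpan ℝ K ≠ ⊤) {d : ℕ}
    (hd : finrank ℝ E ≤ d + 1) : ∃ t, ∀ x ∈ K, t - x ∈ (d : ℝ) • K := by
  obtain ⟨p, hp⟩ := hne
  set V := vectorSpan ℝ K with hV
  have hVtop : V ≠ ⊤ := fun h => hspan
    ((AffineSubspace.affineSpan_eq_top_iff_vectorSpan_eq_top_of_nonempty ℝ E E ⟨p, hp⟩).2 h)
  have hVd : finrank ℝ V ≤ d := by
    have := Submodule.finrank_lt hVtop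
    lia
  let K' : Set V := {v | (v : E) + p ∈ K}
  have hK' : Convex ℝ K' := by
    have := (hK.translate_preimage_left p).linear_preimage V.subtype
    exact this
  have hc' : IsCompact K' :=
    (Submodule.closed_of_finiteDimensional V).isClosedEmbedding_subtypeVal.isCompact_preimage
      ((Homeomorph.addRight p).isCompact_preimage.2 hc)
  obtain ⟨t, ht⟩ := exists_forall_sub_mem_natCast_smul hK' hc' ⟨0, by simpa [K'] using hp⟩ hVd
  -- Undoes the shift by `p` in both `x` and the covering point `k`: `t - (x - p) = d (k - p)`.
  refine ⟨t + p + (d : ℝ) • p, fun x hx => ?_⟩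
  have hxV : x - p ∈ V := vsub_mem_vectorSpan ℝ hx hp
  obtain ⟨k, hk, hkt⟩ := ht ⟨x - p, hxV⟩ (by simpa [K'] using hx)
  refine ⟨_, hk, ?_⟩
  have h2 := congrArg (Subtype.val) hkt
  simp only [Submodule.coe_smul, Submodule.coe_sub] at h2
  simp only [smul_add, h2]
  abel

/-- If some point of `K` has, up to scaling, a representation by the `x j` with a negative
coefficient, then the points `x j` fit into a translate of `-s K` with `s < n`. -/
theorem exists_lt_sub_mem_smul_of_neg_coeff (hK : Convex ℝ K) {n : ℕ} {x : Fin (n + 1) → E}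
    (hx : ∀ i, x i ∈ K) {y : E} (hy : y ∈ K) {b : Fin (n + 1) → ℝ} (hb : 0 ≤ ∑ j, b j)
    (hby : ∑ j, b j • x j = (∑ j, b j) • y) {k : Fin (n + 1)} (hk : b k < 0) :
    ∃ s : ℝ, 0 ≤ s ∧ s < n ∧ ∃ t, ∀ i, t - x i ∈ s • K := by
  set S := ∑ i, ∑ j, |b j| / |b i| with hS
  have hSle : ∀ i j, |b j| / |b i| ≤ S := fun i j =>
    (Finset.single_le_sum (f := fun j => |b j| / |b i|) (fun j _ => by positivity)
      (Finset.mem_univ j)).trans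
    (Finset.single_le_sum (f := fun i => ∑ j, |b j| / |b i|) (fun i _ => by positivity)
      (Finset.mem_univ i))
  have hS0 : 0 ≤ S := by positivity
  -- Chosen so that `1 - ε = ε S`, which keeps every coefficient in `hcoef` nonnegative.
  set ε := 1 / (1 + S) with hε
  have hε0 : 0 < ε := by positivity
  have hε1 : ε * (1 + S) = 1 := by rw [hε]; field_simp
  have hεle : ε ≤ 1 := by nlinarith
  -- The translation is `∑ w j • x j`. Adding `c i` times the relation `∑ b j • x j - (∑ b j) • y =
  -- 0` to its difference with `x i` cancels the coefficient `-ε` at `i` when `b i < 0`. The total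
  -- weight stays `∑ w j - 1`, less than `n` because `w k < 1`.
  let w : Fin (n + 1) → ℝ := fun j => if b j < 0 then 1 - ε else 1
  let c : Fin (n + 1) → ℝ := fun i => if b i < 0 then ε / b i else 0
  have hc0 : ∀ i, c i ≤ 0 := fun i => by
    simp only [c]
    split_ifs with h
    · exact (div_neg_of_pos_of_neg hε0 h).le
    · rfl
  have hw : ∀ j, 1 - ε ≤ w j := fun j => by simp only [w]; split_ifs <;> linarith
  have hcoef : ∀ i j, 0 ≤ w j - (if j = i then 1 else 0) + c i * b j := by
    intro i j
    by_cases hi : b i < 0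
    · have hci : c i = ε / b i := if_pos hi
      rcases eq_or_ne j i with rfl | hij
      · have hwj : w j = 1 - ε := if_pos hi
        rw [hwj, hci, div_mul_cancel₀ _ hi.ne]
        simp
      · have h1 : |c i * b j| ≤ ε * S := by
          rw [hci, abs_mul, abs_div, abs_of_pos hε0, div_mul_eq_mul_div, mul_div_assoc]
          exact mul_le_mul_of_nonneg_left (hSle i j) hε0.le
        have := neg_abs_le (c i * b j)
        have := hw j
        simp only [hij, if_false]
        linarith
    · have hci : c i = 0 := if_neg hi
      rcases eq_or_ne j i with rfl | hij
      · have hwj : w j = 1 := if_neg hi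
        simp [hci, hwj]
      · have := hw j
        simp only [hij, if_false, hci]
        linarith
  have hmem : ∀ i, ∑ j, w j • x j - x i ∈ (∑ j, w j - 1) • K := by
    intro i
    have h1 := sum_smul_mem_smul hK ⟨y, hy⟩ (hcoef i) hx
    have h2 : (-(c i * ∑ j, b j)) • y ∈ (-(c i * ∑ j, b j)) • K := Set.smul_mem_smul_set hy
    have h3 := Set.add_mem_add h1 h2
    have h4 : 0 ≤ -(c i * ∑ j, b j) := by
      have := mul_nonneg (neg_nonneg.2 (hc0 i)) hb
      linarith
    rw [← hK.add_smul (Finset.sum_nonneg fun j _ => hcoef i j) h4] at h3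
    convert h3 using 1
    · congr 1
      simp only [Finset.sum_add_distrib, Finset.sum_sub_distrib, Finset.sum_ite_eq',
        Finset.mem_univ, if_true, ← Finset.mul_sum]
      ring
    · simp only [add_smul, sub_smul, Finset.sum_add_distrib, Finset.sum_sub_distrib, ite_smul,
        one_smul, zero_smul, Finset.sum_ite_eq', Finset.mem_univ, if_true, mul_smul,
        ← Finset.smul_sum, hby, neg_smul]
      abel
  refine ⟨∑ j, w j - 1, ?_, ?_, _, hmem⟩
  · obtain ⟨m, hm⟩ : ∃ m, 0 ≤ b m := by
      by_contra! hcon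
      exact absurd (Finset.sum_neg (fun j _ => hcon j) ⟨k, Finset.mem_univ k⟩) (not_lt.2 hb)
    have hwm : w m = 1 := if_neg (not_lt.2 hm)
    have := Finset.single_le_sum (f := w) (fun j _ => by have := hw j; linarith)
      (Finset.mem_univ m)
    linarith
  · have : ∑ j, w j < ∑ _j : Fin (n + 1), (1 : ℝ) := by
      refine Finset.sum_lt_sum (fun j _ => ?_) ⟨k, Finset.mem_univ k, ?_⟩
      · simp only [w]; split_ifs <;> linarith
      · simp only [w, hk, if_true]; linarith
    simp only [Finset.sum_const, Finset.card_univ, Fintype.card_fin, nsmul_eq_mul, mul_one,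
      Nat.cast_add, Nat.cast_one] at this
    linarith

/-- Any `n + 1` points of a convex body that is not an `n`-simplex fit into a translate of `-s K`
for some `s < n`. -/
theorem exists_lt_sub_mem_smul_of_not_isSimplex [FiniteDimensional ℝ E] (hK : Convex ℝ K) {n : ℕ}
    (hn : finrank ℝ E = n) (hsimp : ¬ IsSimplex n K) {x : Fin (n + 1) → E} (hx : ∀ i, x i ∈ K) :
    ∃ s : ℝ, 0 ≤ s ∧ s < n ∧ ∃ t, ∀ i, t - x i ∈ s • K := by
  by_cases hind : AffineIndependent ℝ x
  · have htop : affineSpan ℝ (Set.range x) = ⊤ := by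
      rw [hind.affineSpan_eq_top_iff_card_eq_finrank_add_one]
      simp [hn]
    let B : AffineBasis (Fin (n + 1)) ℝ E := ⟨x, hind, htop⟩
    have hsub : convexHull ℝ (Set.range x) ⊆ K :=
      convexHull_min (Set.range_subset_iff.2 hx) hK
    obtain ⟨y, hy, hyx⟩ : ∃ y ∈ K, y ∉ convexHull ℝ (Set.range x) := by
      by_contra! hcon
      exact hsimp ⟨x, hind, Set.Subset.antisymm hcon hsub⟩
    have hB : Set.range B = Set.range x := rfl
    rw [← hB, B.convexHull_eq_nonneg_coord] at hyx
    simp only [Set.mem_ofPred_eq, not_forall, not_le] at hyx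
    obtain ⟨k, hk⟩ := hyx
    refine exists_lt_sub_mem_smul_of_neg_coeff hK hx hy (b := fun j => B.coord j y) ?_ ?_ hk
    · rw [B.sum_coord_apply_eq_one]; exact zero_le_one
    · rw [B.sum_coord_apply_eq_one, one_smul]
      exact B.linear_combination_coord_eq_self y
  · rw [affineIndependent_iff] at hind
    push Not at hind
    obtain ⟨J, w, hw0, hw1, k, hkJ, hk⟩ := hind
    let b : Fin (n + 1) → ℝ := fun j => if j ∈ J then w j else 0
    have hb0 : ∑ j, b j = 0 := by simpa [b, Finset.sum_ite_mem] using hw0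
    have hb1 : ∑ j, b j • x j = 0 := by simpa [b, ite_smul, Finset.sum_ite_mem] using hw1
    have hbk : b k ≠ 0 := by simpa [b, hkJ] using hk
    obtain ⟨m, hm⟩ : ∃ m, b m < 0 := by
      by_contra! hcon
      exact hbk ((Finset.sum_eq_zero_iff_of_nonneg fun i _ => hcon i).1 hb0 k (Finset.mem_univ k))
    -- For an affine dependence the coefficients sum to zero, so any point of `K` can serve as `y`.
    exact exists_lt_sub_mem_smul_of_neg_coeff hK hx (hx k) hb0.ge (by rw [hb1, hb0, zero_smul]) hm

/-- The equality case of Minkowski's bound: a convex body that is not an `n`-simplex is covered by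
a translate of `-s K` for some `s < n`. -/
theorem exists_lt_forall_sub_mem_smul [FiniteDimensional ℝ E] (hK : Convex ℝ K)
    (hc : IsCompact K) (hne : K.Nonempty) {n : ℕ} (hn : finrank ℝ E = n) (hn0 : 0 < n)
    (hsimp : ¬ IsSimplex n K) :
    ∃ s : ℝ, 0 ≤ s ∧ s < n ∧ ∃ t, ∀ x ∈ K, t - x ∈ s • K := by
  by_cases hspan : affineSpan ℝ K = ⊤
  swap
  · obtain ⟨d, rfl⟩ : ∃ d, n = d + 1 := ⟨n - 1, by lia⟩
    exact ⟨d, d.cast_nonneg, by simp,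
      exists_forall_sub_mem_smul_of_affineSpan_ne_top hK hc hne hspan hn.le⟩
  obtain ⟨p, hp⟩ := hK.interior_nonempty_iff_affineSpan_eq_top.2 hspan
  have hpK : p ∈ K := interior_subset hp
  have hcpt : IsCompact (Set.univ.pi fun _ : Fin (n + 1) => K) := isCompact_univ_pi fun _ => hc
  have key : ∃ s : ℝ, 0 ≤ s ∧ s < n ∧ ∀ x ∈ Set.univ.pi fun _ : Fin (n + 1) => K,
      ∃ t, ∀ i, t - x i ∈ s • K := by
    refine hcpt.induction_on (p := fun A => ∃ s : ℝ, 0 ≤ s ∧ s < n ∧ ∀ x ∈ A,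
      ∃ t, ∀ i, t - x i ∈ s • K) ?_ ?_ ?_ ?_
    · exact ⟨0, le_rfl, by exact_mod_cast hn0, by simp⟩
    · rintro A B hAB ⟨s, hs, hsn, h⟩
      exact ⟨s, hs, hsn, fun x hx => h x (hAB hx)⟩
    · rintro A B ⟨s, hs, hsn, h⟩ ⟨s', hs', hsn', h'⟩
      refine ⟨max s s', le_max_of_le_left hs, max_lt hsn hsn', ?_⟩
      rintro x (hx | hx)
      · obtain ⟨t, ht⟩ := h x hx
        exact ⟨_, fun i => exists_sub_mem_smul_mono hK hpK hs (le_max_left _ _) (ht i)⟩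
      · obtain ⟨t, ht⟩ := h' x hx
        exact ⟨_, fun i => exists_sub_mem_smul_mono hK hpK hs' (le_max_right _ _) (ht i)⟩
    · intro x hx
      -- Enlarging `s` to `s' < n` leaves room for a multiple of the interior, so a single
      -- translation works for all nearby tuples.
      obtain ⟨s, hs, hsn, t, ht⟩ := exists_lt_sub_mem_smul_of_not_isSimplex hK hn hsimp
        fun i => hx i (Set.mem_univ i)
      obtain ⟨s', hss', hs'n⟩ := exists_between hsn
      have hpos : 0 < s' - s := sub_pos.2 hss'
      let U : Set E := s • K + (s' - s) • interior K
      have hU : IsOpen U := (isOpen_interior.smul₀ hpos.ne').add_left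
      have hUK : U ⊆ s' • K := by
        have h1 : s' • K = s • K + (s' - s) • K := by
          rw [← hK.add_smul hs hpos.le]; congr 1; ring
        rw [h1]
        exact Set.add_subset_add_left (Set.smul_set_mono interior_subset)
      refine ⟨{z | ∀ i, t + (s' - s) • p - z i ∈ U}, mem_nhdsWithin_of_mem_nhds ?_,
        s', hs.trans hss'.le, hs'n, fun z hz => ⟨_, fun i => hUK (hz i)⟩⟩
      refine IsOpen.mem_nhds ?_ fun i => ?_
      · simp only [Set.ofPred_forall]
        exact isOpen_iInter_of_finite fun i => hU.preimage (by fun_prop)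
      · rw [add_sub_right_comm]
        exact Set.add_mem_add (ht i) (Set.smul_mem_smul_set hp)
  obtain ⟨s, hs, hsn, h⟩ := key
  exact ⟨s, hs, hsn, exists_forall_sub_mem_smul hK hc hne hn.le fun x hx =>
    h x fun i _ => hx i⟩

end Reflection

/-! ### From reflected coverings to the diameter-radius inequality -/

section Diameter

variable {E : Type*} [NormedAddCommGroup E] [NormedSpace ℝ E] {K C : Set E}

theorem circumradius_le {ρ : ℝ} (hρ : 0 ≤ ρ) {t : E} (h : K ⊆ t +ᵥ ρ • C) :
    circumradius K C ≤ ρ :=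
  csInf_le ⟨0, fun _ hr => hr.1⟩ ⟨hρ, t, h⟩

/-- The feasible pair `ρ`, `t` is needed because `sInf ∅ = 0`. -/
theorem le_circumradius {ρ r : ℝ} (hρ : 0 ≤ ρ) {t : E} (h : K ⊆ t +ᵥ ρ • C)
    (hr : ∀ ρ' : ℝ, 0 ≤ ρ' → ∀ t : E, K ⊆ t +ᵥ ρ' • C → r ≤ ρ') : r ≤ circumradius K C :=
  le_csInf ⟨ρ, hρ, t, h⟩ fun ρ' ⟨h0, t, ht⟩ => hr ρ' h0 t ht

/-- The direction `s = z` attains the value. Compactness of `K - K` bounds both suprema, which would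
otherwise default to `0`. -/
theorem gauge_le_minDiameter (hK : IsCompact K) (hC : Convex ℝ C) (h0 : C ∈ 𝓝 (0 : E)) {z : E}
    (hz : z ∈ K - K) : gauge C z ≤ minDiameter K C := by
  have hKK : IsCompact (K - K) := by
    rw [sub_eq_add_neg]
    exact hK.add hK.neg
  have hbdd : BddAbove (gauge C '' (K - K)) :=
    hKK.bddAbove_image (continuous_gauge hC h0).continuousOn
  have hlen : ∀ s, 0 ≤ minLength s K C := fun s =>
    Real.sSup_nonneg (by rintro _ ⟨y, -, rfl⟩; exact gauge_nonneg y)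
  rcases eq_or_ne z 0 with rfl | hz0
  · rw [gauge_zero]
    exact Real.sSup_nonneg (by rintro _ ⟨s, -, rfl⟩; exact hlen s)
  · have h1 : gauge C z ≤ minLength z K C :=
      le_csSup (hbdd.mono (Set.image_mono Set.inter_subset_left))
        ⟨z, ⟨hz, Submodule.mem_span_singleton_self z⟩, rfl⟩
    refine h1.trans (le_csSup ?_ ⟨z, hz0, rfl⟩)
    obtain ⟨M, hM⟩ := hbdd
    refine ⟨M, ?_⟩
    rintro _ ⟨s, -, rfl⟩
    refine Real.sSup_le (by rintro _ ⟨y, hy, rfl⟩; exact hM ⟨y, hy.1, rfl⟩) ?_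
    exact (gauge_nonneg z).trans (hM ⟨z, hz, rfl⟩)

theorem minDiameter_le {M : ℝ} (hM : 0 ≤ M) (h : ∀ z ∈ K - K, gauge C z ≤ M) :
    minDiameter K C ≤ M := by
  refine Real.sSup_le ?_ hM
  rintro _ ⟨s, -, rfl⟩
  exact Real.sSup_le (by rintro _ ⟨y, hy, rfl⟩; exact h y hy.1) hM

theorem minDiameter_pos (hK : IsCompact K) (hnt : K.Nontrivial) (hC : Convex ℝ C)
    (hCc : IsCompact C) (h0 : C ∈ 𝓝 (0 : E)) : 0 < minDiameter K C := by
  obtain ⟨x, hx, y, hy, hxy⟩ := hnt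
  refine lt_of_lt_of_le ?_ (gauge_le_minDiameter hK hC h0 (Set.sub_mem_sub hx hy))
  exact (gauge_pos (absorbent_nhds_zero h0)
    ((NormedSpace.isVonNBounded_iff ℝ).2 hCc.isBounded)).2 (sub_ne_zero.2 hxy)

/-- A covering of `K` by a translate of `-s K` yields a covering by a translate of a multiple of
`C`, in terms of the minimum diameter. -/
theorem subset_vadd_minDiameter_smul (hK : IsCompact K) (hnt : K.Nontrivial)
    (hC : Convex ℝ C) (hCc : IsCompact C) (h0 : C ∈ 𝓝 (0 : E)) {s : ℝ} (hs : 0 ≤ s) {t : E}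
    (ht : ∀ x ∈ K, t - x ∈ s • K) :
    K ⊆ ((s + 1)⁻¹ • t) +ᵥ (s / (s + 1) * minDiameter K C) • C := by
  have hD := minDiameter_pos hK hnt hC hCc h0
  intro x hx
  obtain ⟨k, hk, hkx⟩ := ht x hx
  have hmem : x - k ∈ minDiameter K C • C := by
    rw [Set.mem_smul_set_iff_inv_smul_mem₀ hD.ne']
    refine hCc.isClosed.closure_subset ((gauge_le_one_iff_mem_closure hC h0).1 ?_)
    rw [gauge_smul_of_nonneg (inv_nonneg.2 hD.le),
      smul_eq_mul, inv_mul_le_one₀ hD]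
    exact gauge_le_minDiameter hK hC h0 (Set.sub_mem_sub hx hk)
  rw [mul_smul]
  refine ⟨_, Set.smul_mem_smul_set hmem, ?_⟩
  have hs1 : s + 1 ≠ 0 := by positivity
  have hkx' : s • k = t - x := hkx
  change (s + 1)⁻¹ • t + (s / (s + 1)) • (x - k) = x
  rw [div_eq_inv_mul, mul_smul, ← smul_add, smul_sub, hkx',
    inv_smul_eq_iff₀ hs1, add_smul, one_smul]
  abel

theorem circumradius_pos {ρ : ℝ} (hρ : 0 ≤ ρ) {t : E} (h : K ⊆ t +ᵥ ρ • C) (hnt : K.Nontrivial)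
    (hCc : IsCompact C) : 0 < circumradius K C := by
  obtain ⟨x, hx, y, hy, hxy⟩ := hnt
  obtain ⟨M, hM0, hM⟩ := hCc.isBounded.exists_pos_norm_le
  have hd : 0 < ‖x - y‖ := norm_pos_iff.2 (sub_ne_zero.2 hxy)
  refine lt_of_lt_of_le (by positivity : 0 < ‖x - y‖ / (2 * M)) (le_circumradius hρ h ?_)
  intro ρ' hρ' t' h'
  obtain ⟨_, ⟨a, ha, rfl⟩, hax⟩ := h' hx
  obtain ⟨_, ⟨b, hb, rfl⟩, hby⟩ := h' hy
  rw [div_le_iff₀ (by positivity)]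
  have h1 : x - y = ρ' • (a - b) := by
    rw [← hax, ← hby]
    simp [smul_sub]
  rw [h1, norm_smul, Real.norm_of_nonneg hρ']
  refine mul_le_mul_of_nonneg_left ?_ hρ'
  have := norm_sub_le a b
  have := hM a ha
  have := hM b hb
  linarith

variable [FiniteDimensional ℝ E]

/-- The lower bound for the ratio of the minimum diameter and the circumradius, with its equality
case. -/
theorem le_minDiameter_div_circumradius (hKc : Convex ℝ K) (hK : IsCompact K)
    (hnt : K.Nontrivial) (hC : Convex ℝ C) (hCc : IsCompact C) (h0 : C ∈ 𝓝 (0 : E)) {n : ℕ}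
    (hn : finrank ℝ E = n) (hn0 : 0 < n) :
    (n + 1 : ℝ) / (2 * n) ≤ minDiameter K C / (2 * circumradius K C) ∧
      ((n + 1 : ℝ) / (2 * n) = minDiameter K C / (2 * circumradius K C) → IsSimplex n K) := by
  have hn0' : (0 : ℝ) < n := by exact_mod_cast hn0
  have hD := minDiameter_pos hK hnt hC hCc h0
  obtain ⟨t, ht⟩ := exists_forall_sub_mem_natCast_smul hKc hK hnt.nonempty hn.le
  have hsub := subset_vadd_minDiameter_smul hK hnt hC hCc h0 hn0'.le ht
  have hR := circumradius_pos (by positivity) hsub hnt hCc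
  have hle := circumradius_le (by positivity) hsub
  refine ⟨?_, fun heq => ?_⟩
  · rw [div_mul_eq_mul_div, le_div_iff₀ (by positivity)] at hle
    rw [div_le_div_iff₀ (by positivity) (by positivity)]
    linarith
  · by_contra hsimp
    obtain ⟨s, hs, hsn, t, ht⟩ :=
      exists_lt_forall_sub_mem_smul hKc hK hnt.nonempty hn hn0 hsimp
    have hle' := circumradius_le (by positivity)
      (subset_vadd_minDiameter_smul hK hnt hC hCc h0 hs ht)
    rw [div_mul_eq_mul_div, le_div_iff₀ (by positivity)] at hle'
    rw [div_eq_div_iff (by positivity) (by positivity)] at heq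
    -- Eliminating the diameter from `R (s + 1) ≤ s D` and `(n + 1) R = n D` leaves `n R ≤ s R`.
    nlinarith [mul_pos hR (sub_pos.2 hsn)]

end Diameter

/-! ### The extremal simplex and its gauge bodies -/

section Extremal

variable {n : ℕ}

/-- The outer facet normals of a simplex, as linear functionals with vanishing sum. -/
noncomputable def facetCoord (n : ℕ) (i : Fin (n + 1)) : EuclideanSpace ℝ (Fin n) →ₗ[ℝ] ℝ :=
  Fin.cases (-∑ j : Fin n, (EuclideanSpace.proj j : EuclideanSpace ℝ (Fin n) →L[ℝ] ℝ).toLinearMap)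
    (fun j => (EuclideanSpace.proj j : EuclideanSpace ℝ (Fin n) →L[ℝ] ℝ).toLinearMap) i

theorem facetCoord_succ (j : Fin n) (x : EuclideanSpace ℝ (Fin n)) :
    facetCoord n j.succ x = x j := rfl

theorem facetCoord_zero (x : EuclideanSpace ℝ (Fin n)) :
    facetCoord n 0 x = -∑ j, x j := by
  simp [facetCoord]

theorem sum_facetCoord (x : EuclideanSpace ℝ (Fin n)) : ∑ i, facetCoord n i x = 0 := by
  simp [Fin.sum_univ_succ, facetCoord_succ, facetCoord_zero]

theorem exists_facetCoord_eq {y : Fin (n + 1) → ℝ} (hy : ∑ i, y i = 0) :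
    ∃ x, ∀ i, facetCoord n i x = y i := by
  refine ⟨WithLp.toLp 2 fun j => y j.succ, fun i => ?_⟩
  rw [Fin.sum_univ_succ] at hy
  refine Fin.cases ?_ (fun j => ?_) i
  · rw [facetCoord_zero]
    simp only
    linarith
  · rw [facetCoord_succ]

theorem continuous_facetCoord (i : Fin (n + 1)) : Continuous (facetCoord n i) :=
  (facetCoord n i).continuous_of_finiteDimensional

/-- Summing over `i` removes the unknown translation, since the facet functionals add up to zero. -/
theorem le_of_forall_le_facetCoord_add {a c : ℝ} {t : EuclideanSpace ℝ (Fin n)}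
    (h : ∀ i, a ≤ facetCoord n i t + c) : a ≤ c := by
  have h1 := Finset.sum_le_sum fun i (_ : i ∈ Finset.univ) => h i
  rw [Finset.sum_add_distrib, sum_facetCoord] at h1
  simp only [Finset.sum_const, Finset.card_univ, Fintype.card_fin, nsmul_eq_mul, zero_add] at h1
  exact le_of_mul_le_mul_left h1 (by positivity)

theorem exists_facetCoord_eq_of_ne (hn : 0 < n) (i : Fin (n + 1)) (a : ℝ) :
    ∃ x, ∀ j, facetCoord n j x = if j = i then a else -a / n := by
  refine exists_facetCoord_eq ?_
  have hn' : (n : ℝ) ≠ 0 := by exact_mod_cast hn.ne'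
  rw [← Finset.add_sum_erase _ _ (Finset.mem_univ i), Finset.sum_congr rfl
    fun j hj => if_neg (Finset.ne_of_mem_erase hj)]
  simp only [if_true, Finset.sum_const, Finset.card_erase_of_mem (Finset.mem_univ i),
    Finset.card_univ, Fintype.card_fin, nsmul_eq_mul, Nat.add_sub_cancel]
  field_simp
  ring

/-- The intersection `(-T) ∩ (s T)` for a simplex `T` centered at the origin. -/
def truncatedSimplex (n : ℕ) (s : ℝ) : Set (EuclideanSpace ℝ (Fin n)) :=
  {x | ∀ i, facetCoord n i x ∈ Set.Icc (-s) 1}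

theorem convex_truncatedSimplex (s : ℝ) : Convex ℝ (truncatedSimplex n s) := by
  have : truncatedSimplex n s = ⋂ i, facetCoord n i ⁻¹' Set.Icc (-s) 1 := by
    ext; simp [truncatedSimplex]
  rw [this]
  exact convex_iInter fun i => (convex_Icc _ _).linear_preimage _

theorem isCompact_truncatedSimplex (s : ℝ) : IsCompact (truncatedSimplex n s) := by
  have h1 : IsCompact ((EuclideanSpace.equiv (Fin n) ℝ).toHomeomorph ⁻¹'
      (Set.univ.pi fun _ => Set.Icc (-s) 1)) :=
    (Homeomorph.isCompact_preimage _).2 (isCompact_univ_pi fun _ => isCompact_Icc)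
  refine h1.of_isClosed_subset ?_ fun x hx j _ => hx j.succ
  simp only [truncatedSimplex, Set.ofPred_forall]
  exact isClosed_iInter fun i => isClosed_Icc.preimage (continuous_facetCoord i)

theorem zero_mem_interior_truncatedSimplex {s : ℝ} (hs : 0 < s) :
    0 ∈ interior (truncatedSimplex n s) := by
  refine mem_interior.2 ⟨{x | ∀ i, facetCoord n i x ∈ Set.Ioo (-s) 1},
    fun x hx i => Set.Ioo_subset_Icc_self (hx i), ?_, fun i => by simp [hs]⟩
  simp only [Set.ofPred_forall]
  exact isOpen_iInter_of_finite fun i => isOpen_Ioo.preimage (continuous_facetCoord i)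

theorem truncatedSimplex_subset {s : ℝ} (hs : 1 ≤ s) :
    truncatedSimplex n s ⊆ (-s) • truncatedSimplex n s := by
  have hs0 : 0 < s := by linarith
  intro x hx
  rw [Set.mem_smul_set_iff_inv_smul_mem₀ (by linarith)]
  intro i
  obtain ⟨h1, h2⟩ := hx i
  rw [map_smul, smul_eq_mul, inv_neg, neg_mul, ← div_eq_inv_mul]
  constructor
  · rw [neg_le_neg_iff, div_le_iff₀ hs0]
    nlinarith
  · rw [neg_le, le_div_iff₀ hs0]
    linarith

/-- For each `i` the point with `i`-th coordinate `-s` and all others `s / n` lies in the body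
because `s ≤ n`; averaging over `i` gives the bound. Used with `B = -C`, `c = 1` for the asymmetry
and `B = -s C`, `c = s` for centering. -/
theorem le_of_truncatedSimplex_subset (hn : 0 < n) {s c ρ : ℝ} (hs : 0 ≤ s) (hsn : s ≤ n)
    (hρ : 0 ≤ ρ) {B : Set (EuclideanSpace ℝ (Fin n))} (hB : ∀ b ∈ B, ∀ i, -c ≤ facetCoord n i b)
    {t : EuclideanSpace ℝ (Fin n)} (h : truncatedSimplex n s ⊆ t +ᵥ ρ • B) : s ≤ ρ * c := by
  have hn' : (0 : ℝ) < n := by exact_mod_cast hn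
  refine le_of_forall_le_facetCoord_add (t := -t) fun i => ?_
  obtain ⟨x, hx⟩ := exists_facetCoord_eq_of_ne hn i (-s)
  have hxC : x ∈ truncatedSimplex n s := by
    intro j
    rw [hx j, neg_neg]
    have h1 : 0 ≤ s / n := by positivity
    have h2 : s / n ≤ 1 := (div_le_one hn').2 hsn
    split_ifs
    · constructor <;> linarith
    · constructor <;> linarith
  obtain ⟨_, ⟨b, hb, rfl⟩, hbx⟩ := h hxC
  have h1 : facetCoord n i x = facetCoord n i t + ρ * facetCoord n i b := by
    rw [← hbx]; simp
  rw [hx i, if_pos rfl] at h1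
  have := mul_le_mul_of_nonneg_left (hB b hb i) hρ
  rw [map_neg]
  linarith

theorem asymmetry_truncatedSimplex (hn : 0 < n) {s : ℝ} (hs : 1 ≤ s) (hsn : s ≤ n) :
    asymmetry (truncatedSimplex n s) = s := by
  have hsub : truncatedSimplex n s ⊆ (0 : EuclideanSpace ℝ (Fin n)) +ᵥ
      s • (-truncatedSimplex n s) := by
    rw [zero_vadd, Set.smul_set_neg, ← Set.neg_smul_set]
    exact truncatedSimplex_subset hs
  have hs0 : 0 ≤ s := by linarith
  refine le_antisymm (circumradius_le hs0 hsub) (le_circumradius hs0 hsub fun ρ hρ t h => ?_)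
  simpa using le_of_truncatedSimplex_subset hn (c := 1) hs0 hsn hρ
    (fun b hb i => by have := (hb i).2; rw [map_neg] at this; linarith) h

theorem isMinkowskiCentered_truncatedSimplex (hn : 0 < n) {s : ℝ} (hs : 1 ≤ s) (hsn : s ≤ n) :
    IsMinkowskiCentered (truncatedSimplex n s) := by
  have hs0 : 0 < s := by linarith
  unfold IsMinkowskiCentered
  rw [asymmetry_truncatedSimplex hn hs hsn]
  have hsub : truncatedSimplex n s ⊆ (0 : EuclideanSpace ℝ (Fin n)) +ᵥ
      (1 : ℝ) • ((-s) • truncatedSimplex n s) := by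
    rw [zero_vadd, one_smul]
    exact truncatedSimplex_subset hs
  refine ⟨truncatedSimplex_subset hs, le_antisymm (circumradius_le zero_le_one hsub)
    (le_circumradius zero_le_one hsub fun ρ hρ t h => ?_)⟩
  have := le_of_truncatedSimplex_subset hn (c := s) hs0.le hsn hρ (fun b hb i => by
    obtain ⟨a, ha, rfl⟩ := hb
    have := (ha i).2
    rw [map_smul, smul_eq_mul]
    nlinarith) h
  exact le_of_mul_le_mul_right (by linarith) hs0

/-- Equality is attained for a centered simplex and its truncated reflected copies. -/
theorem exists_isSimplex_minDiameter_div_circumradius (hn : 0 < n) {s : ℝ} (hs : 1 ≤ s) :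
    ∃ K : ConvexBody (EuclideanSpace ℝ (Fin n)), IsSimplex n (K : Set (EuclideanSpace ℝ (Fin n))) ∧
      (n + 1 : ℝ) / (2 * n) = minDiameter (K : Set (EuclideanSpace ℝ (Fin n)))
        (truncatedSimplex n s) /
        (2 * circumradius (K : Set (EuclideanSpace ℝ (Fin n))) (truncatedSimplex n s)) := by
  have hn' : (0 : ℝ) < n := by exact_mod_cast hn
  -- Vertices of the simplex on which every facet functional is at least `-1`.
  choose v hv using fun i => exists_facetCoord_eq_of_ne hn i (n : ℝ)
  simp only [neg_div, div_self hn'.ne'] at hv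
  have hind : AffineIndependent ℝ v := by
    rw [affineIndependent_iff]
    intro J w hw0 hw1 i hi
    have h1 := congrArg (facetCoord n i) hw1
    simp only [map_sum, map_smul, smul_eq_mul, hv, map_zero] at h1
    have h2 : ∑ j ∈ J, w j * (if i = j then (n : ℝ) else -1)
        = ∑ j ∈ J, ((if i = j then w j * (n + 1) else 0) - w j) :=
      Finset.sum_congr rfl fun j _ => by split_ifs <;> ring
    rw [h2, Finset.sum_sub_distrib, hw0, Finset.sum_ite_eq, if_pos hi, sub_zero] at h1
    exact (mul_eq_zero.1 h1).resolve_right (by positivity)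
  let K : ConvexBody (EuclideanSpace ℝ (Fin n)) :=
    ⟨convexHull ℝ (Set.range v), convex_convexHull ℝ _,
      (Set.finite_range v).isCompact_convexHull (𝕜 := ℝ), (Set.range_nonempty v).convexHull⟩
  have hvK : ∀ i, v i ∈ (K : Set (EuclideanSpace ℝ (Fin n))) := fun i =>
    subset_convexHull ℝ _ ⟨i, rfl⟩
  refine ⟨K, ⟨v, hind, rfl⟩, ?_⟩
  have hnt : (K : Set (EuclideanSpace ℝ (Fin n))).Nontrivial := by
    have : Nontrivial (Fin (n + 1)) := Fin.nontrivial_iff_two_le.2 (by lia)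
    obtain ⟨i, j, hij⟩ := exists_pair_ne (Fin (n + 1))
    exact ⟨v i, hvK i, v j, hvK j, hind.injective.ne hij⟩
  have hC0 : truncatedSimplex n s ∈ 𝓝 0 :=
    mem_interior_iff_mem_nhds.1 (zero_mem_interior_truncatedSimplex (by linarith))
  have hle := (le_minDiameter_div_circumradius K.convex K.isCompact hnt
    (convex_truncatedSimplex s) (isCompact_truncatedSimplex s) hC0 (by simp) hn).1
  refine le_antisymm hle ?_
  have hbd : ∀ x ∈ (K : Set (EuclideanSpace ℝ (Fin n))), ∀ i,
      facetCoord n i x ∈ Set.Icc (-1 : ℝ) n := by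
    intro x hx i
    refine convexHull_min (t := facetCoord n i ⁻¹' Set.Icc (-1 : ℝ) n) ?_
      ((convex_Icc _ _).linear_preimage _) hx
    rintro _ ⟨j, rfl⟩
    rw [Set.mem_preimage, hv j i]
    split_ifs
    · constructor <;> linarith
    · constructor <;> linarith
  -- Facet functionals vary by at most `n + 1` on `K`, and `s ≥ 1`, so `K - K ⊆ (n + 1) C`.
  have hD : minDiameter (K : Set (EuclideanSpace ℝ (Fin n))) (truncatedSimplex n s) ≤ n + 1 := by
    refine minDiameter_le (by positivity) ?_
    rintro _ ⟨x, hx, y, hy, rfl⟩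
    refine gauge_le_of_mem (by positivity) ?_
    rw [Set.mem_smul_set_iff_inv_smul_mem₀ (by positivity)]
    intro i
    obtain ⟨hx1, hx2⟩ := hbd x hx i
    obtain ⟨hy1, hy2⟩ := hbd y hy i
    rw [map_smul, map_sub, smul_eq_mul, ← div_eq_inv_mul]
    constructor
    · rw [le_div_iff₀ (by positivity)]
      nlinarith
    · rw [div_le_one (by positivity)]
      linarith
  obtain ⟨t, ht⟩ := exists_forall_sub_mem_natCast_smul K.convex K.isCompact K.nonempty
    (d := n) (by simp)
  have hsub := subset_vadd_minDiameter_smul K.isCompact hnt (convex_truncatedSimplex s)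
    (isCompact_truncatedSimplex s) hC0 hn'.le ht
  have hD0 := minDiameter_pos K.isCompact hnt (convex_truncatedSimplex s)
    (isCompact_truncatedSimplex s) hC0
  have hR : (n : ℝ) ≤ circumradius (K : Set (EuclideanSpace ℝ (Fin n)))
      (truncatedSimplex n s) := by
    refine le_circumradius (by positivity) hsub fun ρ hρ t' h => ?_
    -- The vertex `v i` has `i`-th coordinate `n`, while `C` allows at most `1`.
    refine le_of_forall_le_facetCoord_add (t := t') fun i => ?_
    obtain ⟨_, ⟨b, hb, rfl⟩, hbx⟩ := h (hvK i)
    have h1 : facetCoord n i (v i) = facetCoord n i t' + ρ * facetCoord n i b := by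
      rw [← hbx]; simp
    rw [hv i i, if_pos rfl] at h1
    nlinarith [(hb i).2]
  exact div_le_div₀ (by positivity) hD (by positivity) (by linarith)

end Extremal

end GaugeGeometry

theorem mainTheorem7 (n : ℕ) (hn : 2 ≤ n) :
    (∀ K C : ConvexBody (EuclideanSpace ℝ (Fin n)),
      (K : Set (EuclideanSpace ℝ (Fin n))).Nontrivial →
      (0 : EuclideanSpace ℝ (Fin n)) ∈ interior (C : Set (EuclideanSpace ℝ (Fin n))) →
      GaugeGeometry.IsMinkowskiCentered (C : Set (EuclideanSpace ℝ (Fin n))) →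
      ((n : ℝ) + 1) / (2 * (n : ℝ)) ≤
          GaugeGeometry.minDiameter (K : Set (EuclideanSpace ℝ (Fin n))) C /
            (2 * GaugeGeometry.circumradius (K : Set (EuclideanSpace ℝ (Fin n))) C) ∧
      (((n : ℝ) + 1) / (2 * (n : ℝ)) =
          GaugeGeometry.minDiameter (K : Set (EuclideanSpace ℝ (Fin n))) C /
            (2 * GaugeGeometry.circumradius (K : Set (EuclideanSpace ℝ (Fin n))) C) →
        GaugeGeometry.IsSimplex n (K : Set (EuclideanSpace ℝ (Fin n))))) ∧
    (∀ s : ℝ, 1 ≤ s → s ≤ (n : ℝ) →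
      ∃ C : ConvexBody (EuclideanSpace ℝ (Fin n)),
        (0 : EuclideanSpace ℝ (Fin n)) ∈ interior (C : Set (EuclideanSpace ℝ (Fin n))) ∧
        GaugeGeometry.IsMinkowskiCentered (C : Set (EuclideanSpace ℝ (Fin n))) ∧
        GaugeGeometry.asymmetry (C : Set (EuclideanSpace ℝ (Fin n))) = s ∧
        ∃ K : ConvexBody (EuclideanSpace ℝ (Fin n)),
          GaugeGeometry.IsSimplex n (K : Set (EuclideanSpace ℝ (Fin n))) ∧
          ((n : ℝ) + 1) / (2 * (n : ℝ)) =
            GaugeGeometry.minDiameter (K : Set (EuclideanSpace ℝ (Fin n))) C /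
              (2 * GaugeGeometry.circumradius (K : Set (EuclideanSpace ℝ (Fin n))) C)) := by
  refine ⟨fun K C hK h0 _ => ?_, fun s hs hsn => ?_⟩
  · exact GaugeGeometry.le_minDiameter_div_circumradius K.convex K.isCompact hK C.convex
      C.isCompact (mem_interior_iff_mem_nhds.1 h0) (by simp) (by lia)
  · have hn0 : 0 < n := by lia
    refine ⟨⟨GaugeGeometry.truncatedSimplex n s, GaugeGeometry.convex_truncatedSimplex s,
      GaugeGeometry.isCompact_truncatedSimplex s, 0,
      interior_subset (GaugeGeometry.zero_mem_interior_truncatedSimplex (by linarith))⟩,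
      GaugeGeometry.zero_mem_interior_truncatedSimplex (by linarith),
      GaugeGeometry.isMinkowskiCentered_truncatedSimplex hn0 hs hsn,
      GaugeGeometry.asymmetry_truncatedSimplex hn0 hs hsn,
      GaugeGeometry.exists_isSimplex_minDiameter_div_circumradius hn0 hs⟩
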